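/- Let $n\ge 0$. A rook vector of size $n$ is a word $r=r_1\dots r_n$ with letters in $\{0,1,\dots,n\}$ in which every nonzero letter occurs at most once; let $R_n$ be the set of rook vectors of size $n$. The $0$-rook monoid $R_n^0$ is the submonoid, generated by $\pi_0,\pi_1,\dots,\pi_{n-1}$, of the monoid of functions $R_n\to R_n$ acting on the right (so that $r\cdot(xy)=(r\cdot x)\cdot y$), where $$r\cdot\pi_0 = 0\,r_2\dots r_n,\qquad r\cdot\pi_k=\begin{cases} r_1\dots r_{k-1}\,r_{k+1}\,r_k\,r_{k+2}\dots r_n & \text{if } r_k<r_{k+1},\\ r & \text{otherwise,}\end{cases}\qquad 1\le k\le n-1$$ (for $n=0$ both the set $R_0$ and the monoid $R_0^0$ have one element). The $0$-Hecke monoid $H_n^0$ is the monoid generated by $\pi_1,\dots,\pi_{n-1}$ subject to the relations $\pi_i^2=\pi_i$ for $1\le i\le n-1$, $\pi_i\pi_{i+1}\pi_i=\pi_{i+1}\pi_i\pi_{i+1}$ for $1\le i\le n-2$, and $\pi_i\pi_j=\pi_j\pi_i$ for $|i-j|\ge 2$. **Theorem.** The assignment $\pi_i\mapsto\pi_i$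 $(1\le i\le n-1)$ defines an injective monoid morphism $H_n^0\to R_n^0$, through which $H_n^0$ is regarded as a submonoid of $R_n^0$. The monoid algebra $\mathbb{C}[R_n^0]$, with $H_n^0$ acting by left multiplication, is a projective left $\mathbb{C}[H_n^0]$-module. Consequently, every projective left $\mathbb{C}[R_n^0]$-module remains projective when restricted to $\mathbb{C}[H_n^0]$. -/

import Mathlib

/-- Rook vectors of size `n`: words `r₁ … rₙ` in `{0, …, n}` in which every nonzero letter occurs
at most once.  The letter at position `j + 1` is `r.val j`; it is the index of the row holding the
`1` of the column `j + 1` of the corresponding rook matrix, and `0` if that column is zero. -/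
def Rook (n : ℕ) : Type :=
  {r : Fin n → Fin (n + 1) // ∀ i j : Fin n, r i = r j → r i ≠ 0 → i = j}

namespace Rook

variable {n : ℕ}

/-- The position `k + 1` (as an element of `{1, …, n}`), for `0 ≤ k < n - 1`. -/
def posL (k : Fin (n - 1)) : Fin n := ⟨k.val, by have := k.isLt; omega⟩

/-- The position `k + 2` (as an element of `{1, …, n}`), for `0 ≤ k < n - 1`. -/
def posR (k : Fin (n - 1)) : Fin n := ⟨k.val + 1, by have := k.isLt; omega⟩

/-- Right action of the elementary transposition `s_{k+1}`: exchange the letters at the positions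
`k + 1` and `k + 2`. -/
def actS (k : Fin (n - 1)) (r : Rook n) : Rook n :=
  ⟨fun j => r.val (Equiv.swap (posL k) (posR k) j), fun _ _ h h0 =>
    (Equiv.swap (posL k) (posR k)).injective (r.property _ _ h h0)⟩

/-- Right action of `π_{k+1}`: exchange the letters at the positions `k + 1` and `k + 2` if the
first one is smaller than the second one, and do nothing otherwise. -/
def actPi (k : Fin (n - 1)) (r : Rook n) : Rook n :=
  if r.val (posL k) < r.val (posR k) then actS k r else r

/-- Right action of `π₀ = P₁`: replace the first letter by `0`. -/
def actP (r : Rook n) : Rook n :=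
  ⟨fun j => if j.val = 0 then 0 else r.val j, fun i j h h0 => by
    by_cases hi : i.val = 0
    · simp [hi] at h0
    · by_cases hj : j.val = 0
      · simp [hi, hj] at h h0
        exact absurd h h0
      · simp only [hi, hj, if_false] at h h0
        exact r.property i j h h0⟩

end Rook

/-- The `0`-rook monoid `R_n^0`: the submonoid generated by `π₀ = P₁, π₁, …, π_{n-1}` inside the
monoid of functions from the set of rooks to itself.  Functions act on the right, so the product
`x * y` means `x` first and `y` next: this is the opposite of the monoid `Function.End`. -/
def ZeroRook (n : ℕ) : Submonoid (Function.End (Rook n))ᵐᵒᵖ :=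
  Submonoid.closure
    (insert (MulOpposite.op (Rook.actP : Function.End (Rook n)))
      (Set.range fun k : Fin (n - 1) => MulOpposite.op (Rook.actPi k : Function.End (Rook n))))

/-- The generator `π_{k+1}` of `R_n^0`, for `0 ≤ k < n - 1`. -/
def ZeroRook.pi {n : ℕ} (k : Fin (n - 1)) : ZeroRook n :=
  ⟨MulOpposite.op (Rook.actPi k : Function.End (Rook n)),
    Submonoid.subset_closure (Set.mem_insert_of_mem _ (Set.mem_range_self k))⟩

/-- The defining relations of the `0`-Hecke monoid; the letter `k` stands for `π_{k+1}`. -/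
inductive ZeroHeckeRel (n : ℕ) :
    FreeMonoid (Fin (n - 1)) → FreeMonoid (Fin (n - 1)) → Prop
  | idem (i : Fin (n - 1)) :
      ZeroHeckeRel n (FreeMonoid.of i * FreeMonoid.of i) (FreeMonoid.of i)
  | braid (i j : Fin (n - 1)) (h : j.val = i.val + 1) :
      ZeroHeckeRel n (FreeMonoid.of i * FreeMonoid.of j * FreeMonoid.of i)
        (FreeMonoid.of j * FreeMonoid.of i * FreeMonoid.of j)
  | comm (i j : Fin (n - 1)) (h : i.val + 2 ≤ j.val) :
      ZeroHeckeRel n (FreeMonoid.of i * FreeMonoid.of j) (FreeMonoid.of j * FreeMonoid.of i)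

/-- The `0`-Hecke monoid `H_n^0`, by generators `π₁, …, π_{n-1}` and relations. -/
abbrev ZeroHecke (n : ℕ) : Type := PresentedMonoid (ZeroHeckeRel n)

theorem Rook.actPi_val {n : ℕ} (k : Fin (n - 1)) (r : Rook n) (j : Fin n) :
    (Rook.actPi k r).val j =
      if j = Rook.posL k then max (r.val (Rook.posL k)) (r.val (Rook.posR k))
      else if j = Rook.posR k then min (r.val (Rook.posL k)) (r.val (Rook.posR k))
      else r.val j := by
  have hne : Rook.posL k ≠ Rook.posR k := by simp [Rook.posL, Rook.posR]
  unfold Rook.actPi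
  split_ifs with h h1 h2 h1 h2
  · subst h1; simp [Rook.actS, max_eq_right h.le]
  · subst h2; simp [Rook.actS, min_eq_left h.le]
  · simp [Rook.actS, Equiv.swap_apply_of_ne_of_ne h1 h2]
  · subst h1; simp [max_eq_left (not_lt.mp h)]
  · subst h2; simp [min_eq_right (not_lt.mp h)]
  · rfl

theorem ZeroRook.pi_rel {n : ℕ} (a b : FreeMonoid (Fin (n - 1))) (h : ZeroHeckeRel n a b) :
    FreeMonoid.lift (ZeroRook.pi (n := n)) a = FreeMonoid.lift ZeroRook.pi b := by
  have key : ∀ x y : ZeroRook n, (∀ r, x.val.unop r = y.val.unop r) → x = y := fun x y hxy =>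
    Subtype.ext (MulOpposite.unop_injective (funext hxy))
  apply key
  intro r
  apply Subtype.ext
  funext p
  cases h with
  | idem i =>
    simp only [map_mul, FreeMonoid.lift_eval_of]
    change (Rook.actPi i (Rook.actPi i r)).val p = (Rook.actPi i r).val p
    have hp : (p = Rook.posL i) = (p.val = i.val) := propext Fin.ext_iff
    have hp' : (p = Rook.posR i) = (p.val = i.val + 1) := propext Fin.ext_iff
    simp only [Rook.actPi_val]
    grind [Rook.posL, Rook.posR]
  | braid i j h =>
    simp only [map_mul, FreeMonoid.lift_eval_of]
    change (Rook.actPi i (Rook.actPi j (Rook.actPi i r))).val p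
      = (Rook.actPi j (Rook.actPi i (Rook.actPi j r))).val p
    have e : Rook.posL j = Rook.posR i := Fin.ext h
    have h1 : Rook.posL i ≠ Rook.posR i := by simp [Rook.posL, Rook.posR]
    have h2 : Rook.posR i ≠ Rook.posR j := by
      simp only [Rook.posR, ne_eq, Fin.mk.injEq]; omega
    have h3 : Rook.posL i ≠ Rook.posR j := by
      simp only [Rook.posL, Rook.posR, ne_eq, Fin.mk.injEq]; omega
    simp only [Rook.actPi_val, e]
    grind
  | comm i j h =>
    simp only [map_mul, FreeMonoid.lift_eval_of]
    change (Rook.actPi j (Rook.actPi i r)).val p = (Rook.actPi i (Rook.actPi j r)).val p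
    have h1 : Rook.posL i ≠ Rook.posL j := by
      simp only [Rook.posL, ne_eq, Fin.mk.injEq]; omega
    have h2 : Rook.posL i ≠ Rook.posR j := by
      simp only [Rook.posL, Rook.posR, ne_eq, Fin.mk.injEq]; omega
    have h3 : Rook.posR i ≠ Rook.posL j := by
      simp only [Rook.posL, Rook.posR, ne_eq, Fin.mk.injEq]; omega
    have h4 : Rook.posR i ≠ Rook.posR j := by
      simp only [Rook.posR, ne_eq, Fin.mk.injEq]; omega
    simp only [Rook.actPi_val]
    grind

/-- The canonical morphism `H_n^0 → R_n^0`, sending `π_i` to `π_i` for `1 ≤ i ≤ n - 1`. -/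
def ZeroHecke.toZeroRook (n : ℕ) : ZeroHecke n →* ZeroRook n :=
  PresentedMonoid.lift ZeroRook.pi ZeroRook.pi_rel

/-- The morphism of monoid algebras `ℂ[H_n^0] → ℂ[R_n^0]` induced by `H_n^0 → R_n^0`. -/
noncomputable def ZeroHecke.algebraMap (n : ℕ) :
    MonoidAlgebra ℂ (ZeroHecke n) →+* MonoidAlgebra ℂ (ZeroRook n) :=
  MonoidAlgebra.mapDomainRingHom ℂ (ZeroHecke.toZeroRook n)

/-- The restriction to `H_n^0` of a left `R_n^0`-module `M`: the same abelian group, on which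
`a ∈ ℂ[H_n^0]` acts as its image in `ℂ[R_n^0]`. -/
noncomputable abbrev ZeroHecke.restrict (n : ℕ) (M : Type*) [AddCommGroup M]
    [Module (MonoidAlgebra ℂ (ZeroRook n)) M] : Module (MonoidAlgebra ℂ (ZeroHecke n)) M :=
  Module.compHom M (ZeroHecke.algebraMap n)

/-!
The `0`-Hecke monoid `H = H_n^0` acts from the left on words of length `n` over any linearly
ordered alphabet, `π_k` sorting two adjacent letters into decreasing order; monotone maps between
alphabets commute with this action. All rearrangements of a strictly increasing word are reached
from it, and the coset normal form (`exists_mul_descProd`) shows that `H` has at most `n!`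
elements. Hence `H` acts simply transitively on these rearrangements
(`ZeroHecke.wordAct_injective`).

Transposing rook matrices turns the right operations of `R = R_n^0` on rooks into left ones. Left
and right operations commute (`Rook.transpose_actPi_comm` and its companions), and both generate
all rooks from the identity rook (`Rook.induction`), so `x ↦ 1 · x` is a bijection from `R` to the
set of rooks. Under this bijection, followed by transposition, left multiplication of `R` by `H`
becomes the sorting action of `H` on the words which are rooks
(`ZeroRook.colWord_toZeroRook_mul`). In particular `H → R` is injective, as `1` corresponds to a
strictly increasing word.

The zeros of such a word can be made distinct without losing equivariance: order them decreasingly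
from left to right, below all other letters (`Rook.standardize_actPi`). The resulting word with
distinct letters is `a · e` for its increasing rearrangement `e` and a unique `a` in `H`. Merging
the zeros again gives `x = a * c`, where `a` depends equivariantly on `x` and `c` depends only on
`e`, which is invariant under `H`. So `R` is, as a left `H`-set, a retract of a disjoint union of
copies of `H`, and `ℂ[R]` is a direct summand of a free `ℂ[H]`-module
(`MonoidAlgebra.projective_of_retract`). Restriction to `ℂ[H]` then preserves all projective
modules, which are retracts of direct sums of copies of `ℂ[R]`.
-/

/-! ### Normal forms in the `0`-Hecke monoid -/

section NormalForm

variable {M : Type*} [Monoid M] {g : ℕ → M}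

/-- The descending product `g (l + j - 1) * ⋯ * g (l + 1) * g l` of `j` factors. -/
def descProd (g : ℕ → M) : ℕ → ℕ → M
  | _, 0 => 1
  | l, j + 1 => descProd g (l + 1) j * g l

theorem commute_descProd (hc : ∀ i j, i + 2 ≤ j → Commute (g i) (g j)) (i l j : ℕ)
    (h : i + 2 ≤ l) : Commute (g i) (descProd g l j) := by
  induction j generalizing l with
  | zero => exact Commute.one_right _
  | succ j ih => exact (ih (l + 1) (by omega)).mul_right (hc i l h)

/-- A letter which is not the lowest one of a descending product moves through it to the left, its
index dropping by one. -/
theorem descProd_mul {N : ℕ} (hc : ∀ i j, i + 2 ≤ j → Commute (g i) (g j))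
    (hb : ∀ i, i + 1 < N → g i * g (i + 1) * g i = g (i + 1) * g i * g (i + 1))
    (l j i : ℕ) (hl : l ≤ i) (hi : i + 1 < l + j) (hN : l + j ≤ N) :
    descProd g l j * g (i + 1) = g i * descProd g l j := by
  induction j generalizing l with
  | zero => omega
  | succ j ih =>
    rcases hl.lt_or_eq with h | rfl
    · rw [descProd, mul_assoc, (hc l (i + 1) (by omega)).eq, ← mul_assoc,
        ih (l + 1) h (by omega) (by omega), mul_assoc]
    · obtain ⟨j, rfl⟩ : ∃ j', j = j' + 1 := ⟨j - 1, by omega⟩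
      rw [descProd, descProd, mul_assoc, mul_assoc, ← mul_assoc (g (l + 1)), ← hb l (by omega),
        mul_assoc, ← mul_assoc, ← (commute_descProd hc l (l + 1 + 1) j (by omega)).eq]
      simp only [mul_assoc]

/-- The coset normal form: if the `g i` satisfy the relations of a `0`-Hecke monoid, then each
product of `g 0, …, g m` is a product of `g 0, …, g (m - 1)` times a descending product which
starts with `g m` or is empty. -/
theorem exists_mul_descProd {N : ℕ} (hc : ∀ i j, i + 2 ≤ j → Commute (g i) (g j))
    (hb : ∀ i, i + 1 < N → g i * g (i + 1) * g i = g (i + 1) * g i * g (i + 1))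
    (hi : ∀ i, g i * g i = g i) (m : ℕ) (hm : m < N) (x : M)
    (hx : x ∈ Submonoid.closure (g '' Set.Iio (m + 1))) :
    ∃ c ∈ Submonoid.closure (g '' Set.Iio m), ∃ j, j ≤ m + 1 ∧
      x = c * descProd g (m + 1 - j) j := by
  induction hx using Submonoid.closure_induction_right with
  | one => exact ⟨1, one_mem _, 0, by omega, by simp [descProd]⟩
  | mul_right x _ y hy ih =>
    obtain ⟨c, hcm, j, hj, rfl⟩ := ih
    obtain ⟨i, him, rfl⟩ := hy
    rw [Set.mem_Iio] at him
    have hmem : ∀ i, i < m → g i ∈ Submonoid.closure (g '' Set.Iio m) := fun i h =>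
      Submonoid.subset_closure ⟨i, h, rfl⟩
    obtain ⟨l, hl⟩ : ∃ l, l = m + 1 - j := ⟨_, rfl⟩
    rw [← hl]
    rcases lt_trichotomy i l with h | rfl | h
    · rcases Nat.lt_or_ge (i + 1) l with h' | h'
      · refine ⟨c * g i, mul_mem hcm (hmem i (by omega)), j, hj, ?_⟩
        rw [← hl, mul_assoc, mul_assoc, (commute_descProd hc i l j (by omega)).eq]
      · refine ⟨c, hcm, j + 1, by omega, ?_⟩
        rw [show m + 1 - (j + 1) = i by omega, descProd, show i + 1 = l by omega, mul_assoc]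
    · obtain ⟨j, rfl⟩ : ∃ j', j = j' + 1 := ⟨j - 1, by omega⟩
      refine ⟨c, hcm, j + 1, hj, ?_⟩
      rw [← hl, descProd, mul_assoc, mul_assoc, hi]
    · obtain ⟨i, rfl⟩ : ∃ i', i = i' + 1 := ⟨i - 1, by omega⟩
      refine ⟨c * g i, mul_mem hcm (hmem i (by omega)), j, hj, ?_⟩
      rw [← hl, mul_assoc, mul_assoc, descProd_mul hc hb l j i (by omega) (by omega) (by omega)]

/-- Adjoining the generator `g m` multiplies the size by at most `m + 2`, the number of descending
products in the normal form. -/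
theorem ncard_closure_le {N : ℕ} (hc : ∀ i j, i + 2 ≤ j → Commute (g i) (g j))
    (hb : ∀ i, i + 1 < N → g i * g (i + 1) * g i = g (i + 1) * g i * g (i + 1))
    (hi : ∀ i, g i * g i = g i) (m : ℕ) (hm : m ≤ N) :
    (Submonoid.closure (g '' Set.Iio m) : Set M).Finite ∧
      (Submonoid.closure (g '' Set.Iio m) : Set M).ncard ≤ (m + 1).factorial := by
  induction m with
  | zero => simp
  | succ m ih =>
    obtain ⟨hf, hcard⟩ := ih (by omega)
    have hsub : (Submonoid.closure (g '' Set.Iio (m + 1)) : Set M) ⊆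
        (fun p : M × ℕ => p.1 * descProd g (m + 1 - p.2) p.2) ''
          ((Submonoid.closure (g '' Set.Iio m) : Set M) ×ˢ Set.Iio (m + 2)) := by
      intro x hx
      obtain ⟨c, hcm, j, hj, rfl⟩ := exists_mul_descProd hc hb hi m (by omega) x hx
      exact ⟨(c, j), ⟨hcm, by simp only [Set.mem_Iio]; omega⟩, rfl⟩
    have hfin := hf.prod (Set.finite_Iio (m + 2))
    refine ⟨(hfin.image _).subset hsub, ?_⟩
    calc _ ≤ _ := Set.ncard_le_ncard hsub (hfin.image _)
      _ ≤ _ := Set.ncard_image_le hfin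
      _ = (Submonoid.closure (g '' Set.Iio m) : Set M).ncard * (m + 2) := by
        rw [Set.ncard_prod, ← Nat.card_coe_set_eq (Set.Iio (m + 2))]; simp
      _ ≤ (m + 1).factorial * (m + 2) := Nat.mul_le_mul_right _ hcard
      _ = (m + 1 + 1).factorial := by rw [Nat.factorial_succ (m + 1), mul_comm]

end NormalForm

theorem ZeroHecke.finite_and_card_le (n : ℕ) :
    Finite (ZeroHecke n) ∧ Nat.card (ZeroHecke n) ≤ n.factorial := by
  -- The extension of the generators by `1` to all indices satisfies the idempotency and commutation
  -- relations everywhere.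
  let g : ℕ → ZeroHecke n := fun i =>
    if h : i < n - 1 then PresentedMonoid.of (ZeroHeckeRel n) ⟨i, h⟩ else 1
  have hrel : ∀ a b, ZeroHeckeRel n a b →
      PresentedMonoid.mk (ZeroHeckeRel n) a = PresentedMonoid.mk (ZeroHeckeRel n) b :=
    fun a b h => PresentedMonoid.mk_eq_mk_of_rel h
  have hc : ∀ i j, i + 2 ≤ j → Commute (g i) (g j) := by
    intro i j h
    by_cases hj : j < n - 1
    · have hi : i < n - 1 := by omega
      simp only [g, hi, hj, dif_pos]
      exact hrel _ _ (ZeroHeckeRel.comm ⟨i, hi⟩ ⟨j, hj⟩ h)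
    · simp [g, hj]
  have hb : ∀ i, i + 1 < n - 1 → g i * g (i + 1) * g i = g (i + 1) * g i * g (i + 1) := by
    intro i hi
    have hi' : i < n - 1 := by omega
    simp only [g, hi, hi', dif_pos]
    exact hrel _ _ (ZeroHeckeRel.braid ⟨i, hi'⟩ ⟨i + 1, hi⟩ rfl)
  have hid : ∀ i, g i * g i = g i := by
    intro i
    by_cases hi : i < n - 1
    · simp only [g, hi, dif_pos]
      exact hrel _ _ (ZeroHeckeRel.idem ⟨i, hi⟩)
    · simp [g, hi]
  have htop : (Submonoid.closure (g '' Set.Iio (n - 1)) : Set (ZeroHecke n)) = Set.univ := by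
    rw [← Submonoid.coe_top, SetLike.coe_set_eq, eq_top_iff,
      ← PresentedMonoid.closure_range_of (ZeroHeckeRel n), Submonoid.closure_le]
    rintro _ ⟨k, rfl⟩
    exact Submonoid.subset_closure ⟨k.val, k.isLt, by simp [g]⟩
  obtain ⟨hf, hcard⟩ := ncard_closure_le hc hb hid (n - 1) le_rfl
  rw [htop] at hf hcard
  refine ⟨Set.finite_univ_iff.mp hf, ?_⟩
  rw [← Set.ncard_univ]
  refine hcard.trans (le_of_eq ?_)
  cases n <;> rfl

/-! ### The action of the `0`-Hecke monoid on words -/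

theorem Rook.posL_ne_posR {n : ℕ} (k : Fin (n - 1)) : Rook.posL k ≠ Rook.posR k := by
  simp [Rook.posL, Rook.posR]

section Words

variable {n : ℕ} {L L' : Type*} [LinearOrder L] [LinearOrder L']

/-- Sort the letters of the word `t` at the positions `k + 1` and `k + 2` into decreasing order. -/
def sortAt (k : Fin (n - 1)) (t : Fin n → L) : Fin n → L := fun j =>
  if j = Rook.posL k then max (t (Rook.posL k)) (t (Rook.posR k))
  else if j = Rook.posR k then min (t (Rook.posL k)) (t (Rook.posR k))
  else t j

theorem sortAt_of_lt {k : Fin (n - 1)} {t : Fin n → L}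
    (h : t (Rook.posL k) < t (Rook.posR k)) :
    sortAt k t = t ∘ Equiv.swap (Rook.posL k) (Rook.posR k) := by
  have := Rook.posL_ne_posR k
  funext j
  simp only [sortAt, Function.comp, Equiv.swap_apply_def]
  grind

theorem sortAt_of_not_lt {k : Fin (n - 1)} {t : Fin n → L}
    (h : ¬ t (Rook.posL k) < t (Rook.posR k)) : sortAt k t = t := by
  have := Rook.posL_ne_posR k
  funext j
  simp only [sortAt]
  grind

theorem exists_sortAt_eq_comp (k : Fin (n - 1)) (t : Fin n → L) :
    ∃ s : Equiv.Perm (Fin n), sortAt k t = t ∘ s := by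
  by_cases h : t (Rook.posL k) < t (Rook.posR k)
  · exact ⟨_, sortAt_of_lt h⟩
  · exact ⟨1, sortAt_of_not_lt h⟩

theorem sortAt_comp {f : L → L'} (hf : Monotone f) (k : Fin (n - 1)) (t : Fin n → L) :
    sortAt k (f ∘ t) = f ∘ sortAt k t := by
  funext j
  simp only [sortAt, Function.comp, ← hf.map_max, ← hf.map_min]
  split_ifs <;> rfl

/-- The `0`-Hecke monoid acts from the left on words of length `n` over a linearly ordered
alphabet, `π_k` sorting the letters at the positions `k` and `k + 1` into decreasing order. -/
def ZeroHecke.wordAct (n : ℕ) (L : Type*) [LinearOrder L] :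
    ZeroHecke n →* Function.End (Fin n → L) :=
  PresentedMonoid.lift (M := Function.End (Fin n → L)) (fun k => sortAt k) <| by
    intro a b h
    funext t p
    cases h with
    | idem i =>
      simp only [map_mul]
      change sortAt i (sortAt i t) p = sortAt i t p
      have h1 := Rook.posL_ne_posR i
      simp only [sortAt]
      grind
    | braid i j h =>
      simp only [map_mul]
      change sortAt i (sortAt j (sortAt i t)) p = sortAt j (sortAt i (sortAt j t)) p
      have e : Rook.posL j = Rook.posR i := Fin.ext h
      have h1 := Rook.posL_ne_posR i
      have h2 : Rook.posR i ≠ Rook.posR j := by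
        simp only [Rook.posR, ne_eq, Fin.mk.injEq]; omega
      have h3 : Rook.posL i ≠ Rook.posR j := by
        simp only [Rook.posL, Rook.posR, ne_eq, Fin.mk.injEq]; omega
      simp only [sortAt, e]
      grind
    | comm i j h =>
      simp only [map_mul]
      change sortAt i (sortAt j t) p = sortAt j (sortAt i t) p
      have h1 : Rook.posL i ≠ Rook.posL j := by
        simp only [Rook.posL, ne_eq, Fin.mk.injEq]; omega
      have h2 : Rook.posL i ≠ Rook.posR j := by
        simp only [Rook.posL, Rook.posR, ne_eq, Fin.mk.injEq]; omega
      have h3 : Rook.posR i ≠ Rook.posL j := by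
        simp only [Rook.posL, Rook.posR, ne_eq, Fin.mk.injEq]; omega
      have h4 : Rook.posR i ≠ Rook.posR j := by
        simp only [Rook.posR, ne_eq, Fin.mk.injEq]; omega
      simp only [sortAt]
      grind

theorem ZeroHecke.wordAct_of (k : Fin (n - 1)) (t : Fin n → L) :
    ZeroHecke.wordAct n L (PresentedMonoid.of _ k) t = sortAt k t := rfl

theorem ZeroHecke.wordAct_mul (a b : ZeroHecke n) (t : Fin n → L) :
    ZeroHecke.wordAct n L (a * b) t = ZeroHecke.wordAct n L a (ZeroHecke.wordAct n L b t) := by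
  rw [map_mul]; rfl

theorem ZeroHecke.wordAct_one (t : Fin n → L) : ZeroHecke.wordAct n L 1 t = t := by
  rw [map_one]; rfl

/-- Induction on an element of the `0`-Hecke monoid, by multiplication from the left. -/
theorem ZeroHecke.induction_left {p : ZeroHecke n → Prop} (one : p 1)
    (of_mul : ∀ k a, p a → p (PresentedMonoid.of _ k * a)) (a : ZeroHecke n) : p a := by
  induction a using PresentedMonoid.inductionOn with
  | _ w =>
    induction w using FreeMonoid.inductionOn' with
    | one => exact one
    | of_mul k w ih => exact of_mul k _ ih

theorem ZeroHecke.wordAct_comp {f : L → L'} (hf : Monotone f) (a : ZeroHecke n)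
    (t : Fin n → L) :
    ZeroHecke.wordAct n L' a (f ∘ t) = f ∘ ZeroHecke.wordAct n L a t := by
  induction a using ZeroHecke.induction_left with
  | one => simp only [ZeroHecke.wordAct_one]
  | of_mul k a ih =>
    rw [ZeroHecke.wordAct_mul, ih, ZeroHecke.wordAct_of, sortAt_comp hf,
      ZeroHecke.wordAct_mul, ZeroHecke.wordAct_of]

theorem ZeroHecke.exists_wordAct_eq_comp (a : ZeroHecke n) (t : Fin n → L) :
    ∃ s : Equiv.Perm (Fin n), ZeroHecke.wordAct n L a t = t ∘ s := by
  induction a using ZeroHecke.induction_left with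
  | one => exact ⟨1, ZeroHecke.wordAct_one t⟩
  | of_mul k a ih =>
    obtain ⟨s, hs⟩ := ih
    obtain ⟨s', hs'⟩ := exists_sortAt_eq_comp k (t ∘ s)
    exact ⟨s * s', by rw [ZeroHecke.wordAct_mul, hs, ZeroHecke.wordAct_of, hs']; rfl⟩

end Words

/-! ### Transposition of rooks and the commuting left and right operations -/

namespace Rook

variable {n : ℕ}

/-- The identity rook `1 2 … n`. -/
def one : Rook n := ⟨Fin.succ, fun _ _ h _ => Fin.succ_injective n h⟩

theorem eq_of_eq_succ_iff {x y : Fin (n + 1)} (h : ∀ i, x = Fin.succ i ↔ y = Fin.succ i) :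
    x = y := by
  rcases Fin.eq_zero_or_eq_succ x with h0 | ⟨i, hi⟩
  · rcases Fin.eq_zero_or_eq_succ y with h1 | ⟨i, hi⟩
    · rw [h0, h1]
    · rw [hi, (h i).mpr hi]
  · rw [hi, (h i).mp hi]

theorem ext_succ {r s : Rook n} (h : ∀ j i, r.val j = Fin.succ i ↔ s.val j = Fin.succ i) :
    r = s :=
  Subtype.ext (funext fun j => eq_of_eq_succ_iff (h j))

theorem eq_of_val_eq_succ (r : Rook n) {i j k : Fin n} (hi : r.val i = k.succ)
    (hj : r.val j = k.succ) : i = j :=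
  r.property i j (hi.trans hj.symm) (by rw [hi]; exact Fin.succ_ne_zero k)

open Classical in
/-- The transpose of a rook: its letter at the position `i` is the position of the letter `i`
in the given rook, or `0` if the letter `i` does not occur there. -/
noncomputable def transpose (r : Rook n) : Rook n :=
  ⟨fun i => if h : ∃ j, r.val j = i.succ then h.choose.succ else 0, fun i i' h h0 => by
    by_cases hi : ∃ j, r.val j = i.succ
    · by_cases hi' : ∃ j, r.val j = i'.succ
      · simp only [hi, hi', dif_pos, Fin.succ_inj] at h
        have h1 := hi.choose_spec
        have h2 := hi'.choose_spec
        rw [h, h2, Fin.succ_inj] at h1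
        exact h1.symm
      · simp [hi, hi', -Fin.exists_succ_eq] at h
    · simp [hi] at h0⟩

theorem transpose_val_eq_succ (r : Rook n) (i j : Fin n) :
    r.transpose.val i = j.succ ↔ r.val j = i.succ := by
  by_cases hi : ∃ j, r.val j = i.succ
  · simp only [transpose, hi, dif_pos, Fin.succ_inj]
    constructor
    · rintro rfl
      exact hi.choose_spec
    · exact fun h => r.eq_of_val_eq_succ hi.choose_spec h
  · simp only [transpose, hi, dif_neg, not_false_iff]
    exact ⟨fun h => absurd h.symm (Fin.succ_ne_zero j), fun h => absurd ⟨j, h⟩ hi⟩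

theorem transpose_transpose (r : Rook n) : r.transpose.transpose = r :=
  ext_succ fun j i => by rw [transpose_val_eq_succ, transpose_val_eq_succ]

theorem transpose_one : (one : Rook n).transpose = one :=
  ext_succ fun j i => by
    rw [transpose_val_eq_succ]; simp only [one, Fin.succ_inj]; exact eq_comm

theorem actPi_val_eq_sortAt (k : Fin (n - 1)) (r : Rook n) :
    (actPi k r).val = sortAt k r.val :=
  funext (actPi_val k r)

theorem actPi_of_lt {k : Fin (n - 1)} {r : Rook n} (h : r.val (posL k) < r.val (posR k)) :
    actPi k r = actS k r := if_pos h

theorem actPi_of_not_lt {k : Fin (n - 1)} {r : Rook n}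
    (h : ¬ r.val (posL k) < r.val (posR k)) : actPi k r = r := if_neg h

theorem posL_lt_posR (k : Fin (n - 1)) : posL k < posR k := Nat.lt_succ_self k.val

theorem actS_val (k : Fin (n - 1)) (r : Rook n) (j : Fin n) :
    (actS k r).val j = r.val (Equiv.swap (posL k) (posR k) j) := rfl

/-- Exchanging two adjacent rows of a rook matrix exchanges two adjacent letters. -/
theorem transpose_actS_transpose_val (k : Fin (n - 1)) (r : Rook n) (j : Fin n) :
    (actS k r.transpose).transpose.val j =
      Equiv.swap (posL k).succ (posR k).succ (r.val j) := by
  refine eq_of_eq_succ_iff fun i => ?_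
  rw [transpose_val_eq_succ, actS_val, transpose_val_eq_succ, Equiv.swap_apply_eq_iff,
    (Fin.succ_injective n).swap_apply]

theorem actS_transpose_comm (j k : Fin (n - 1)) (r : Rook n) :
    (actS k (actS j r).transpose).transpose = actS j (actS k r.transpose).transpose := by
  apply Subtype.ext
  funext a
  rw [transpose_actS_transpose_val, actS_val, actS_val, transpose_actS_transpose_val]

theorem swap_lt_swap_iff {m : ℕ} {u v x y : Fin m} (huv : v.val = u.val + 1)
    (h1 : ¬ (x = u ∧ y = v)) (h2 : ¬ (x = v ∧ y = u)) :
    Equiv.swap u v x < Equiv.swap u v y ↔ x < y := by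
  simp only [Equiv.swap_apply_def]
  split_ifs <;> simp only [Fin.ext_iff, Fin.lt_def] at * <;> omega

/-- Exchanging the letters `k + 1` and `k + 2` affects the order of the letters at the positions
`j + 1` and `j + 2` only if it is these two letters which stand there. -/
theorem transpose_actS_transpose_lt_iff {j k : Fin (n - 1)} {r : Rook n}
    (h1 : ¬ (r.val (posL j) = (posL k).succ ∧ r.val (posR j) = (posR k).succ))
    (h2 : ¬ (r.val (posL j) = (posR k).succ ∧ r.val (posR j) = (posL k).succ)) :
    (actS k r.transpose).transpose.val (posL j) < (actS k r.transpose).transpose.val (posR j) ↔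
      r.val (posL j) < r.val (posR j) := by
  rw [transpose_actS_transpose_val, transpose_actS_transpose_val]
  exact swap_lt_swap_iff rfl h1 h2

/-- The transposed action of `π_k` commutes with the action of `π_j`. Each of them exchanges two
rows or two columns of the rook matrix under a condition, and the only way in which one can affect
the condition of the other is that these rows and columns meet in a permutation matrix. -/
theorem transpose_actPi_comm (j k : Fin (n - 1)) (r : Rook n) :
    (actPi k (actPi j r).transpose).transpose = actPi j (actPi k r.transpose).transpose := by
  have hj := (posL_lt_posR j)
  have hk := (posL_lt_posR k)
  by_cases h1 : r.val (posL j) = (posL k).succ ∧ r.val (posR j) = (posR k).succ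
  · -- the four entries form an identity matrix, which either operation makes antidiagonal
    obtain ⟨hl, hr⟩ := h1
    have hl' := (transpose_val_eq_succ r _ _).mpr hl
    have hr' := (transpose_val_eq_succ r _ _).mpr hr
    have e1 : actPi j r = actS j r := actPi_of_lt (by rw [hl, hr]; simpa using hk)
    have e2 : actPi k r.transpose = actS k r.transpose :=
      actPi_of_lt (by rw [hl', hr']; simpa using hj)
    have e3 : actS j r = (actS k r.transpose).transpose := by
      apply Subtype.ext
      funext a
      rw [transpose_actS_transpose_val, actS_val]
      by_cases ha : a = posL j
      · subst ha; simp [hl, hr]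
      by_cases hb : a = posR j
      · subst hb; simp [hl, hr]
      rw [Equiv.swap_apply_of_ne_of_ne ha hb, Equiv.swap_apply_of_ne_of_ne]
      · exact fun h => ha (r.eq_of_val_eq_succ h hl)
      · exact fun h => hb (r.eq_of_val_eq_succ h hr)
    rw [e1, e2, ← e3]
    have e4 : actPi k (actS j r).transpose = (actS j r).transpose := by
      apply actPi_of_not_lt
      rw [e3, transpose_transpose, actS_val, actS_val, Equiv.swap_apply_left,
        Equiv.swap_apply_right, hl', hr']
      simpa using hj.le
    have e5 : actPi j (actS j r) = actS j r := by
      apply actPi_of_not_lt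
      rw [actS_val, actS_val, Equiv.swap_apply_left, Equiv.swap_apply_right, hl, hr]
      simpa using hk.le
    rw [e4, e5, transpose_transpose]
  by_cases h2 : r.val (posL j) = (posR k).succ ∧ r.val (posR j) = (posL k).succ
  · -- the four entries form an antidiagonal matrix, which both operations fix
    obtain ⟨hl, hr⟩ := h2
    have hl' := (transpose_val_eq_succ r _ _).mpr hl
    have hr' := (transpose_val_eq_succ r _ _).mpr hr
    have e1 : actPi j r = r := actPi_of_not_lt (by rw [hl, hr]; simpa using hk.le)
    have e2 : actPi k r.transpose = r.transpose :=
      actPi_of_not_lt (by rw [hl', hr']; simpa using hj.le)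
    rw [e1, e2, transpose_transpose, e1]
  · -- otherwise neither operation affects the condition which decides the other one
    have c1 := transpose_actS_transpose_lt_iff h1 h2
    have c2 := transpose_actS_transpose_lt_iff (j := k) (k := j) (r := r.transpose)
      (by simp only [transpose_val_eq_succ]; exact h1)
      (by simp only [transpose_val_eq_succ]; tauto)
    rw [transpose_transpose] at c2
    by_cases d1 : r.val (posL j) < r.val (posR j)
    · by_cases d2 : r.transpose.val (posL k) < r.transpose.val (posR k)
      · rw [actPi_of_lt d1, actPi_of_lt d2, actPi_of_lt (c2.mpr d2), actPi_of_lt (c1.mpr d1),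
          actS_transpose_comm]
      · rw [actPi_of_lt d1, actPi_of_not_lt d2, actPi_of_not_lt (mt c2.mp d2),
          transpose_transpose, transpose_transpose, actPi_of_lt d1]
    · by_cases d2 : r.transpose.val (posL k) < r.transpose.val (posR k)
      · rw [actPi_of_not_lt d1, actPi_of_lt d2, actPi_of_not_lt (mt c1.mp d1)]
      · rw [actPi_of_not_lt d1, actPi_of_not_lt d2, transpose_transpose, actPi_of_not_lt d1]

/-- Replacing the first letter of a rook by `0` amounts to the replacement of the letter `1` of
its transpose by `0`, which is a monotone operation on letters. -/
theorem transpose_actP_transpose_val (r : Rook n) :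
    (actP r.transpose).transpose.val =
      (fun x : Fin (n + 1) => if x.val = 1 then 0 else x) ∘ r.val := by
  funext j
  refine eq_of_eq_succ_iff fun i => ?_
  rw [transpose_val_eq_succ, Function.comp]
  by_cases hi : i.val = 0
  · simp only [actP, hi, if_true, Fin.ext_iff, Fin.val_succ, Fin.val_zero]
    split_ifs <;> simp_all
  · simp only [actP, hi, if_false]
    rw [transpose_val_eq_succ]
    split_ifs with h
    · simp only [Fin.ext_iff, Fin.val_succ, Fin.val_zero]
      omega
    · rfl

theorem transpose_actP_actPi_comm (j : Fin (n - 1)) (r : Rook n) :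
    (actP (actPi j r).transpose).transpose = actPi j (actP r.transpose).transpose := by
  apply Subtype.ext
  rw [actPi_val_eq_sortAt, transpose_actP_transpose_val, transpose_actP_transpose_val,
    actPi_val_eq_sortAt, sortAt_comp]
  intro x y h
  dsimp only
  split_ifs with h1 h2 h2
  · exact le_rfl
  · exact Fin.zero_le _
  · have : x.val ≤ y.val := h
    simp only [Fin.le_def, Fin.val_zero]
    omega
  · exact h

/-- This is `transpose_actP_actPi_comm` conjugated by transposition. -/
theorem transpose_actPi_actP_comm (k : Fin (n - 1)) (r : Rook n) :
    (actPi k (actP r).transpose).transpose = actP (actPi k r.transpose).transpose := by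
  have := transpose_actP_actPi_comm k r.transpose
  rw [transpose_transpose] at this
  rw [← this, transpose_transpose]

theorem transpose_actP_comm (r : Rook n) :
    (actP (actP r).transpose).transpose = actP (actP r.transpose).transpose := by
  apply Subtype.ext
  rw [transpose_actP_transpose_val]
  funext j
  change _ = if j.val = 0 then 0 else (actP r.transpose).transpose.val j
  rw [transpose_actP_transpose_val]
  by_cases hj : j.val = 0 <;> simp [actP, hj]

theorem transpose_actS_one (k : Fin (n - 1)) :
    (actS k (one : Rook n)).transpose = actS k one := by
  refine ext_succ fun j i => ?_
  rw [transpose_val_eq_succ, actS_val, actS_val]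
  simp only [one, Fin.succ_inj]
  rw [Equiv.swap_apply_eq_iff, eq_comm]

theorem transpose_actPi_one (k : Fin (n - 1)) :
    (actPi k (one : Rook n)).transpose = actPi k one := by
  rw [actPi_of_lt (by simpa [one] using posL_lt_posR k), transpose_actS_one]

end Rook

/-! ### Rooks, permutations and the identity word -/

namespace Rook

variable {n : ℕ}

theorem actPi_actS {k : Fin (n - 1)} {r : Rook n} (h : r.val (posR k) < r.val (posL k)) :
    actPi k (actS k r) = r := by
  rw [actPi_of_lt (by rwa [actS_val, actS_val, Equiv.swap_apply_left, Equiv.swap_apply_right])]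
  apply Subtype.ext
  funext j
  rw [actS_val, actS_val, Equiv.swap_apply_self]

/-- A rook without descents whose first letter is not `0` is the identity. -/
theorem eq_one_of_not_lt {r : Rook n} (hr : ∀ k, ¬ r.val (posR k) < r.val (posL k))
    (h0 : ∀ j : Fin n, j.val = 0 → r.val j ≠ 0) : r = one := by
  cases n with
  | zero => exact Subtype.ext (funext fun j => j.elim0)
  | succ n =>
    have hmono : Monotone r.val := Fin.monotone_iff_le_succ.mpr fun i => not_lt.mp (hr i)
    have hne : ∀ j, r.val j ≠ 0 := fun j h =>
      h0 0 rfl (le_antisymm ((hmono (Fin.zero_le j)).trans h.le) (Fin.zero_le _))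
    have hs : StrictMono fun j => (r.val j).pred (hne j) := fun i j hij => by
      rw [Fin.pred_lt_pred_iff]
      exact (hmono hij.le).lt_of_ne fun h => hij.ne (r.property i j h (hne i))
    apply Subtype.ext
    funext j
    have := le_antisymm (hs.apply_le (x := j)) hs.le_apply
    exact (Fin.succ_pred _ (hne j)).symm.trans (congrArg Fin.succ this)

theorem exists_letter_notMem {r : Rook n} {i : Fin n} (hi : r.val i = 0) :
    ∃ v : Fin (n + 1), v ≠ 0 ∧ ∀ j, r.val j ≠ v := by
  by_contra! h
  choose g hg using fun v : Fin n => h v.succ (Fin.succ_ne_zero v)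
  have hinj : Function.Injective g := fun v w hvw =>
    Fin.succ_injective n (by rw [← hg v, ← hg w, hvw])
  obtain ⟨v, rfl⟩ := Finite.surjective_of_injective hinj i
  exact Fin.succ_ne_zero v ((hg v).symm.trans hi)

/-- All rooks are obtained from the identity by the right action of `π₀, …, π_{n-1}`: a descent can
be undone, and so can the erasure of the first letter. Both steps increase the word in the
lexicographic order which compares words from the right. -/
theorem induction {p : Rook n → Prop} (one : p one) (actPi : ∀ k r, p r → p (actPi k r))
    (actP : ∀ r, p r → p (actP r)) (r : Rook n) : p r := by
  let f : Rook n → Lex ((Fin n)ᵒᵈ → Fin (n + 1)) := fun r =>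
    toLex fun j => r.val (OrderDual.ofDual j)
  induction h : f r using WellFoundedGT.induction generalizing r with
  | _ x ih =>
    subst h
    by_cases hd : ∃ k, r.val (posR k) < r.val (posL k)
    · obtain ⟨k, hk⟩ := hd
      rw [← actPi_actS hk]
      refine actPi k _ (ih _ ?_ _ rfl)
      refine ⟨OrderDual.toDual (posR k), fun j hj => ?_, ?_⟩
      · have hj' : posR k < OrderDual.ofDual j := hj
        change r.val _ = (actS k r).val _
        rw [actS_val, Equiv.swap_apply_of_ne_of_ne ((posL_lt_posR k).trans hj').ne' hj'.ne']
      · change r.val _ < (actS k r).val _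
        rw [OrderDual.ofDual_toDual, actS_val, Equiv.swap_apply_right]
        exact hk
    push Not at hd
    by_cases h0 : ∃ j : Fin n, j.val = 0 ∧ r.val j = 0
    · obtain ⟨i, hi, hri⟩ := h0
      obtain ⟨v, hv, hvr⟩ := exists_letter_notMem hri
      let s : Rook n := ⟨Function.update r.val i v, fun a b hab ha => by
        rw [Function.update_apply, Function.update_apply] at hab
        rw [Function.update_apply] at ha
        split_ifs at hab ha with h1 h2 h2
        · exact h1.trans h2.symm
        · exact absurd hab.symm (hvr b)
        · exact absurd hab (hvr a)
        · exact r.property a b hab ha⟩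
      have hs : Rook.actP s = r := by
        apply Subtype.ext
        funext j
        have : j.val = 0 ↔ j = i := by rw [Fin.ext_iff, hi]
        simp only [Rook.actP, this, s, Function.update_apply]
        split_ifs with h
        · rw [h, hri]
        · rfl
      rw [← hs]
      refine actP s (ih _ ?_ _ rfl)
      refine ⟨OrderDual.toDual i, fun j hj => ?_, ?_⟩
      · have hj' : i < OrderDual.ofDual j := hj
        exact (Function.update_of_ne hj'.ne' _ _).symm
      · change r.val i < Function.update r.val i v i
        rw [Function.update_self, hri]
        exact Fin.pos_of_ne_zero hv
    · push Not at h0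
      rw [eq_one_of_not_lt (fun k => not_lt.mpr (hd k)) h0]
      exact one

end Rook

namespace ZeroRook

variable {n : ℕ}

/-- The generator `π₀` of the `0`-rook monoid. -/
def p (n : ℕ) : ZeroRook n :=
  ⟨MulOpposite.op (Rook.actP : Function.End (Rook n)),
    Submonoid.subset_closure (Set.mem_insert _ _)⟩

/-- The right action of the `0`-rook monoid on rooks: `act x r` is `r · x`. -/
def act (x : ZeroRook n) (r : Rook n) : Rook n := x.val.unop r

theorem act_mul (x y : ZeroRook n) (r : Rook n) : act (x * y) r = act y (act x r) := rfl

theorem act_pi (k : Fin (n - 1)) (r : Rook n) : act (ZeroRook.pi k) r = Rook.actPi k r := rfl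

/-- An operation on rooks which commutes with the generators of the `0`-rook monoid commutes with
all of it. -/
theorem act_comm_of_generators {f : Rook n → Rook n}
    (hpi : ∀ k r, f (Rook.actPi k r) = Rook.actPi k (f r))
    (hp : ∀ r, f (Rook.actP r) = Rook.actP (f r)) (x : ZeroRook n) (r : Rook n) :
    act x (f r) = f (act x r) := by
  obtain ⟨x, hx⟩ := x
  change x.unop (f r) = f (x.unop r)
  induction hx using Submonoid.closure_induction generalizing r with
  | mem x hx =>
    rcases hx with rfl | ⟨k, rfl⟩
    · exact (hp r).symm
    · exact (hpi k r).symm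
  | one => rfl
  | mul x y _ _ hx hy =>
    change y.unop (x.unop (f r)) = f (y.unop (x.unop r))
    rw [hx, hy]

theorem act_transpose_actPi_transpose (x : ZeroRook n) (k : Fin (n - 1)) (r : Rook n) :
    act x (Rook.actPi k r.transpose).transpose = (Rook.actPi k (act x r).transpose).transpose :=
  act_comm_of_generators (f := fun r => (Rook.actPi k r.transpose).transpose)
    (fun j r => Rook.transpose_actPi_comm j k r) (Rook.transpose_actPi_actP_comm k) x r

theorem act_transpose_actP_transpose (x : ZeroRook n) (r : Rook n) :
    act x (Rook.actP r.transpose).transpose = (Rook.actP (act x r).transpose).transpose :=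
  act_comm_of_generators (f := fun r => (Rook.actP r.transpose).transpose)
    Rook.transpose_actP_actPi_comm Rook.transpose_actP_comm x r

/-- An element of the `0`-rook monoid is determined by its value at the identity rook, because
the transposed operations commute with it and generate all rooks from the identity. -/
theorem act_one_injective : Function.Injective fun x : ZeroRook n => act x Rook.one := by
  intro x y hxy
  have h : ∀ r : Rook n, act x r.transpose = act y r.transpose := by
    intro r
    induction r using Rook.induction with
    | one => rw [Rook.transpose_one]; exact hxy
    | actPi k r ih =>
      have hx := act_transpose_actPi_transpose x k r.transpose
      have hy := act_transpose_actPi_transpose y k r.transpose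
      rw [Rook.transpose_transpose] at hx hy
      rw [hx, hy, ih]
    | actP r ih =>
      have hx := act_transpose_actP_transpose x r.transpose
      have hy := act_transpose_actP_transpose y r.transpose
      rw [Rook.transpose_transpose] at hx hy
      rw [hx, hy, ih]
  refine Subtype.ext (MulOpposite.unop_injective (funext fun r => ?_))
  have := h r.transpose
  rwa [Rook.transpose_transpose] at this

theorem exists_act_one_eq (r : Rook n) : ∃ x : ZeroRook n, act x Rook.one = r := by
  induction r using Rook.induction with
  | one => exact ⟨1, rfl⟩
  | actPi k r ih =>
    obtain ⟨x, rfl⟩ := ih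
    exact ⟨x * ZeroRook.pi k, rfl⟩
  | actP r ih =>
    obtain ⟨x, rfl⟩ := ih
    exact ⟨x * p n, rfl⟩

/-- The column word of `x`: its letter at the position `i` is the column which holds the letter `i`
in the rook `1 · x`, or `0` if there is none. -/
noncomputable def colWord (x : ZeroRook n) : Rook n := (act x Rook.one).transpose

theorem colWord_injective : Function.Injective (colWord (n := n)) := fun x y h =>
  act_one_injective (by
    have := congrArg Rook.transpose h
    rwa [colWord, colWord, Rook.transpose_transpose, Rook.transpose_transpose] at this)

theorem exists_colWord_eq (r : Rook n) : ∃ x : ZeroRook n, colWord x = r := by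
  obtain ⟨x, hx⟩ := exists_act_one_eq r.transpose
  exact ⟨x, by rw [colWord, hx, Rook.transpose_transpose]⟩

theorem colWord_one : colWord (1 : ZeroRook n) = Rook.one := Rook.transpose_one

/-- Left multiplication by `π_k` acts first on the identity rook, where it agrees with its transposed
operation; that operation then passes through `x`. -/
theorem colWord_pi_mul (k : Fin (n - 1)) (x : ZeroRook n) :
    colWord (ZeroRook.pi k * x) = Rook.actPi k (colWord x) := by
  have h := act_transpose_actPi_transpose x k Rook.one
  rw [Rook.transpose_one, Rook.transpose_actPi_one] at h
  rw [colWord, act_mul, act_pi, h, Rook.transpose_transpose, colWord]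

theorem colWord_toZeroRook_mul (a : ZeroHecke n) (x : ZeroRook n) :
    (colWord (ZeroHecke.toZeroRook n a * x)).val =
      ZeroHecke.wordAct n (Fin (n + 1)) a (colWord x).val := by
  induction a using ZeroHecke.induction_left with
  | one => rw [map_one, one_mul, ZeroHecke.wordAct_one]
  | of_mul k a ih =>
    rw [map_mul, mul_assoc, ZeroHecke.wordAct_mul, ZeroHecke.wordAct_of, ← ih,
      ← Rook.actPi_val_eq_sortAt, ← colWord_pi_mul]
    rfl

end ZeroRook

namespace ZeroHecke

variable {n : ℕ} {L : Type*} [LinearOrder L]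

/-- All permutations are reached from the identity word. -/
theorem exists_wordAct_id_eq (σ : Equiv.Perm (Fin n)) :
    ∃ a : ZeroHecke n, wordAct n (Fin n) a id = σ := by
  -- Permutations are the rooks without the letter `0`, which are reached without `π₀`.
  suffices H : ∀ r : Rook n, (∀ j, r.val j ≠ 0) →
      ∃ a : ZeroHecke n, wordAct n (Fin (n + 1)) a Rook.one.val = r.val by
    obtain ⟨a, ha⟩ := H ⟨Fin.succ ∘ σ, fun i j h _ =>
      σ.injective (Fin.succ_injective n h)⟩ fun j => Fin.succ_ne_zero _
    exact ⟨a, (Fin.succ_injective n).comp_left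
      ((wordAct_comp Fin.strictMono_succ.monotone a id).symm.trans ha)⟩
  intro r
  induction r using Rook.induction with
  | one => exact fun _ => ⟨1, wordAct_one _⟩
  | actPi k r ih =>
    intro h
    obtain ⟨s, hs⟩ := exists_sortAt_eq_comp k r.val
    rw [← Rook.actPi_val_eq_sortAt] at hs
    obtain ⟨a, ha⟩ := ih fun j => by
      have := h (s.symm j)
      rwa [hs, Function.comp, Equiv.apply_symm_apply] at this
    exact ⟨PresentedMonoid.of _ k * a, by
      rw [wordAct_mul, ha, wordAct_of, Rook.actPi_val_eq_sortAt]⟩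
  | actP r ih =>
    intro h
    have hr : Rook.actP r = r := by
      apply Subtype.ext
      funext j
      have := h j
      simp only [Rook.actP] at this ⊢
      split_ifs at this ⊢
      · exact absurd rfl this
      · rfl
    rw [hr] at h ⊢
    exact ih h

/-- Distinct elements of the `0`-Hecke monoid send a strictly increasing word to distinct words:
the monoid has at most `n!` elements, and they reach all `n!` rearrangements of the word. -/
theorem wordAct_injective {e : Fin n → L} (he : StrictMono e) :
    Function.Injective fun a => wordAct n L a e := by
  choose s hs using fun a : ZeroHecke n => exists_wordAct_eq_comp a (id : Fin n → Fin n)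
  have hsurj : Function.Surjective s := fun σ => by
    obtain ⟨a, ha⟩ := exists_wordAct_id_eq σ
    exact ⟨a, Equiv.coe_fn_injective ((hs a).symm.trans ha)⟩
  obtain ⟨hfin, hcard⟩ := finite_and_card_le n
  have hbij := hsurj.bijective_of_nat_card_le
    (by rwa [Nat.card_eq_fintype_card (α := Equiv.Perm (Fin n)), Fintype.card_perm,
      Fintype.card_fin])
  intro a b hab
  have h : ∀ c, wordAct n L c e = e ∘ s c := fun c => by
    rw [← Function.comp_id e, wordAct_comp he.monotone, hs, Function.comp_id, Function.id_comp]
  apply hbij.injective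
  apply Equiv.coe_fn_injective
  apply he.injective.comp_left
  change e ∘ s a = e ∘ s b
  rw [← h, ← h]
  exact hab

theorem exists_wordAct_eq_comp_perm {e : Fin n → L} (he : Monotone e)
    (σ : Equiv.Perm (Fin n)) : ∃ a : ZeroHecke n, wordAct n L a e = e ∘ σ := by
  obtain ⟨a, ha⟩ := exists_wordAct_id_eq σ
  exact ⟨a, by rw [← ha, ← wordAct_comp he, Function.comp_id]⟩

/-- The elements of the `0`-Hecke monoid are told apart by their action on the column word of `1`,
which is strictly increasing. -/
theorem toZeroRook_injective (n : ℕ) : Function.Injective (toZeroRook n) := by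
  intro a b hab
  apply wordAct_injective (e := (Rook.one : Rook n).val) Fin.strictMono_succ
  dsimp only
  rw [← ZeroRook.colWord_one, ← ZeroRook.colWord_toZeroRook_mul,
    ← ZeroRook.colWord_toZeroRook_mul, hab]

end ZeroHecke

/-! ### Projectivity of monoid algebras -/

section Algebra

/-- If `B` is projective over `A`, then restriction along `A → B` preserves projective modules, which
are retracts of direct sums of copies of `B`. -/
theorem Module.Projective.compHom {A B : Type*} [Ring A] [Ring B] (f : A →+* B)
    (hB : letI := Module.compHom B f; Module.Projective A B)
    (M : Type*) [AddCommGroup M] [Module B M] (hM : Module.Projective B M) :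
    letI := Module.compHom M f
    Module.Projective A M := by
  let := Module.compHom B f
  let := Module.compHom M f
  have : Module.Projective A B := hB
  obtain ⟨s, hs⟩ := hM.out
  let i : M →ₗ[A] (M →₀ B) :=
    { s.toAddMonoidHom with
      map_smul' := fun a x => by
        change s (f a • x) = _
        rw [map_smul]
        ext
        rfl }
  let q : (M →₀ B) →ₗ[A] M :=
    { (Finsupp.linearCombination B id).toAddMonoidHom with
      map_smul' := fun a x => by
        change Finsupp.linearCombination B id (f a • x) = _
        rw [map_smul]
        rfl }
  classical
  have : Module.Projective A (M →₀ B) :=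
    Module.Projective.of_equiv (finsuppLequivDFinsupp A (ι := M) (M := B)).symm
  exact Module.Projective.of_split i q (LinearMap.ext hs)

/-- Let `φ : H → R` be a morphism of monoids, and let each `x : R` be written as `φ (h x) * c x`
such that `h` is equivariant and `c` invariant under left multiplication by `H`. Then `R` is, as an
`H`-set, a retract of a disjoint union of copies of `H`, so `k[R]` is projective over `k[H]`. -/
theorem MonoidAlgebra.projective_of_retract {k H R : Type*} [Ring k] [Monoid H] [Monoid R]
    (φ : H →* R) (h : R → H) (c : R → R) (hh : ∀ a x, h (φ a * x) = a * h x)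
    (hc : ∀ a x, c (φ a * x) = c x) (hx : ∀ x, φ (h x) * c x = x) :
    letI := Module.compHom (MonoidAlgebra k R) (MonoidAlgebra.mapDomainRingHom k φ)
    Module.Projective (MonoidAlgebra k H) (MonoidAlgebra k R) := by
  let := Module.compHom (MonoidAlgebra k R) (MonoidAlgebra.mapDomainRingHom k φ)
  have single_smul (a : H) (r : k) (x : R) (s : k) :
      (single a r : MonoidAlgebra k H) • (single x s : MonoidAlgebra k R) =
        single (φ a * x) (r * s) := by
    change MonoidAlgebra.mapDomainRingHom k φ (single a r) * single x s = _
    simp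
  let i₀ : MonoidAlgebra k R →+ (R →₀ MonoidAlgebra k H) :=
    (Finsupp.liftAddHom fun x =>
      (Finsupp.singleAddHom (c x)).comp (singleAddHom (h x))).comp
        (coeffAddEquiv (R := k) (M := R)).toAddMonoidHom
  have hi₀ (x : R) (s : k) : i₀ (single x s) = Finsupp.single (c x) (single (h x) s) := by
    simp [i₀]
  let i : MonoidAlgebra k R →ₗ[MonoidAlgebra k H] (R →₀ MonoidAlgebra k H) :=
    { i₀ with
      map_smul' := fun a b => by
        change i₀ (a • b) = a • i₀ b
        induction a using MonoidAlgebra.induction_linear with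
        | zero => simp
        | add a a' ha ha' => rw [add_smul, map_add, ha, ha', add_smul]
        | single a r =>
          induction b using MonoidAlgebra.induction_linear with
          | zero => simp
          | add b b' hb hb' => rw [smul_add, map_add, hb, hb', map_add, smul_add]
          | single x s =>
            rw [single_smul, hi₀, hi₀, hh, hc, Finsupp.smul_single, smul_eq_mul,
              single_mul_single] }
  let q : (R →₀ MonoidAlgebra k H) →ₗ[MonoidAlgebra k H] MonoidAlgebra k R :=
    Finsupp.linearCombination (MonoidAlgebra k H) fun x => single x 1
  refine Module.Projective.of_split i q (LinearMap.ext fun b => ?_)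
  induction b using MonoidAlgebra.induction_linear with
  | zero => simp
  | add b b' hb hb' => rw [map_add, hb, hb', map_add]
  | single x s =>
    change q (i₀ (single x s)) = single x s
    rw [hi₀, Finsupp.linearCombination_single, single_smul, hx, mul_one]

end Algebra

/-! ### Standardization and the orbits of the `0`-Hecke monoid -/

namespace Rook

variable {n : ℕ}

/-- The number of letters `0` of `r` to the right of the position `i`. -/
def zerosAfter (r : Rook n) (i : Fin n) : ℕ :=
  (Finset.univ.filter fun j => i < j ∧ r.val j = 0).card

/-- The standardization of a rook: its letters `0` are made distinct, decreasing from left to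
right, and stay smaller than all other letters. -/
def standardize (r : Rook n) : Fin n → Fin (n + 1) ×ₗ ℕ := fun i =>
  toLex (r.val i, if r.val i = 0 then r.zerosAfter i else 0)

theorem standardize_congr {r s : Rook n} {i j : Fin n} (h : r.val i = s.val j)
    (hz : r.val i = 0 → r.zerosAfter i = s.zerosAfter j) : r.standardize i = s.standardize j := by
  unfold standardize
  by_cases h0 : r.val i = 0
  · rw [if_pos h0, if_pos (h ▸ h0), h, hz h0]
  · rw [if_neg h0, if_neg (h ▸ h0), h]

theorem zerosAfter_lt {r : Rook n} {i j : Fin n} (hij : i < j) (hj : r.val j = 0) :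
    r.zerosAfter j < r.zerosAfter i := by
  apply Finset.card_lt_card
  rw [Finset.ssubset_iff_of_subset]
  · exact ⟨j, by simp [hij, hj], by simp⟩
  · intro a
    simp only [Finset.mem_filter, Finset.mem_univ, true_and]
    exact fun h => ⟨hij.trans h.1, h.2⟩

theorem standardize_injective (r : Rook n) : Function.Injective r.standardize := by
  intro i j h
  have h' := toLex.injective h
  rw [Prod.mk.injEq] at h'
  obtain ⟨h1, h2⟩ := h'
  by_cases hi : r.val i = 0
  · have hj : r.val j = 0 := h1 ▸ hi
    rw [if_pos hi, if_pos hj] at h2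
    rcases lt_trichotomy i j with hij | hij | hij
    · exact absurd h2 (zerosAfter_lt hij hj).ne'
    · exact hij
    · exact absurd h2 (zerosAfter_lt hij hi).ne
  · exact r.property i j h1 hi

theorem monotone_fst_ofLex :
    Monotone fun x : Fin (n + 1) ×ₗ ℕ => (ofLex x).1 := fun _ _ h =>
  Prod.Lex.monotone_fst _ _ h

theorem fst_standardize (r : Rook n) :
    (fun x : Fin (n + 1) ×ₗ ℕ => (ofLex x).1) ∘ r.standardize = r.val := rfl

theorem zerosAfter_actS_of_ne (k : Fin (n - 1)) (r : Rook n) {i : Fin n} (hi : i ≠ posL k) :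
    (actS k r).zerosAfter i = r.zerosAfter i := by
  have hs : ∀ j, i < j ↔ i < Equiv.swap (posL k) (posR k) j := by
    intro j
    have h0 : i.val ≠ k.val := fun h => hi (Fin.ext h)
    simp only [Equiv.swap_apply_def, posL, posR]
    split_ifs <;> simp only [Fin.ext_iff, Fin.lt_def] at * <;> omega
  refine Finset.card_equiv (Equiv.swap (posL k) (posR k)) fun j => ?_
  rw [Finset.mem_filter, Finset.mem_filter, actS_val, ← hs]
  simp only [Finset.mem_univ, true_and]

theorem zerosAfter_posL {k : Fin (n - 1)} {r : Rook n} (h : r.val (posR k) ≠ 0) :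
    r.zerosAfter (posL k) = r.zerosAfter (posR k) := by
  refine congrArg Finset.card (Finset.filter_congr fun j _ => and_congr_left fun hj => ?_)
  have : j ≠ posR k := fun e => h (e ▸ hj)
  simp only [posL, posR, Fin.ext_iff, Fin.lt_def, ne_eq] at *
  omega

/-- Standardization is equivariant: two adjacent letters `0` are fixed by sorting, and so are the
decreasing letters which replace them. -/
theorem standardize_actPi (k : Fin (n - 1)) (r : Rook n) :
    (actPi k r).standardize = sortAt k r.standardize := by
  by_cases h : r.val (posL k) < r.val (posR k)
  · have hR : r.val (posR k) ≠ 0 := (Fin.zero_le _).trans_lt h |>.ne'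
    rw [actPi_of_lt h, sortAt_of_lt (Prod.Lex.toLex_lt_toLex.mpr (Or.inl h))]
    funext i
    refine standardize_congr (actS_val k r i) fun h0 => ?_
    rw [actS_val] at h0
    by_cases hL : i = posL k
    · rw [hL, Equiv.swap_apply_left] at h0
      exact absurd h0 hR
    · rw [zerosAfter_actS_of_ne k r hL]
      by_cases hi : i = posR k
      · rw [hi, Equiv.swap_apply_right, zerosAfter_posL hR]
      · rw [Equiv.swap_apply_of_ne_of_ne hL hi]
  · rw [actPi_of_not_lt h, sortAt_of_not_lt]
    rw [not_lt] at h ⊢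
    rcases h.lt_or_eq with h | h
    · exact (Prod.Lex.toLex_lt_toLex.mpr (Or.inl h)).le
    · have h0 : r.val (posR k) = 0 := by
        by_contra h0
        exact (posL_ne_posR k) (r.property _ _ h h0).symm
      refine (Prod.Lex.toLex_lt_toLex.mpr (Or.inr ⟨h, ?_⟩)).le
      dsimp only
      rw [if_pos h0, if_pos (h ▸ h0)]
      exact zerosAfter_lt (posL_lt_posR k) h0

end Rook

namespace ZeroRook

variable {n : ℕ}

theorem standardize_colWord_toZeroRook_mul (a : ZeroHecke n) (x : ZeroRook n) :
    (colWord (ZeroHecke.toZeroRook n a * x)).standardize =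
      ZeroHecke.wordAct n _ a (colWord x).standardize := by
  induction a using ZeroHecke.induction_left with
  | one => rw [map_one, one_mul, ZeroHecke.wordAct_one]
  | of_mul k a ih =>
    rw [map_mul, mul_assoc, ZeroHecke.wordAct_mul, ZeroHecke.wordAct_of, ← ih,
      ← Rook.standardize_actPi, ← colWord_pi_mul]
    rfl

/-- The increasing rearrangement of the standardized column word of `x`. -/
noncomputable def sortedWord (x : ZeroRook n) : Fin n → Fin (n + 1) ×ₗ ℕ :=
  (colWord x).standardize ∘ Tuple.sort (colWord x).standardize

theorem strictMono_sortedWord (x : ZeroRook n) : StrictMono (sortedWord x) :=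
  (Tuple.monotone_sort _).strictMono_of_injective
    ((colWord x).standardize_injective.comp (Equiv.injective _))

/-- The `0`-Hecke monoid permutes the letters of a word, so the sorted word does not change. -/
theorem sortedWord_toZeroRook_mul (a : ZeroHecke n) (x : ZeroRook n) :
    sortedWord (ZeroHecke.toZeroRook n a * x) = sortedWord x := by
  obtain ⟨s, hs⟩ := ZeroHecke.exists_wordAct_eq_comp a (colWord x).standardize
  rw [sortedWord, standardize_colWord_toZeroRook_mul, hs, sortedWord]
  exact Tuple.comp_perm_comp_sort_eq_comp_sort

theorem exists_wordAct_sortedWord (x : ZeroRook n) :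
    ∃ a : ZeroHecke n, ZeroHecke.wordAct n _ a (sortedWord x) = (colWord x).standardize := by
  obtain ⟨a, ha⟩ := ZeroHecke.exists_wordAct_eq_comp_perm (strictMono_sortedWord x).monotone
    (Tuple.sort (colWord x).standardize).symm
  refine ⟨a, ha.trans (funext fun i => ?_)⟩
  simp [sortedWord]

/-- Merging the zeros of the sorted word gives a rearrangement of the column word, hence a rook. -/
theorem exists_colWord_eq_sortedWord (x : ZeroRook n) :
    ∃ y : ZeroRook n, (colWord y).val = fun i => (ofLex (sortedWord x i)).1 := by
  obtain ⟨y, hy⟩ := exists_colWord_eq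
    (⟨(colWord x).val ∘ Tuple.sort (colWord x).standardize, fun i j h h0 =>
      Equiv.injective _ ((colWord x).property _ _ h h0)⟩ : Rook n)
  exact ⟨y, by rw [hy]; rfl⟩

/-- The element of the `0`-Hecke monoid which sends the sorted word of `x` to its standardized
column word. -/
noncomputable def heckePart (x : ZeroRook n) : ZeroHecke n :=
  (exists_wordAct_sortedWord x).choose

theorem wordAct_heckePart (x : ZeroRook n) :
    ZeroHecke.wordAct n _ (heckePart x) (sortedWord x) = (colWord x).standardize :=
  (exists_wordAct_sortedWord x).choose_spec

/-- The representative of the `H_n^0`-orbit of `x` whose column word is increasing. -/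
noncomputable def orbitRep (x : ZeroRook n) : ZeroRook n :=
  (exists_colWord_eq_sortedWord x).choose

theorem colWord_orbitRep (x : ZeroRook n) :
    (colWord (orbitRep x)).val = (fun x => (ofLex x).1) ∘ sortedWord x :=
  (exists_colWord_eq_sortedWord x).choose_spec

theorem heckePart_toZeroRook_mul (a : ZeroHecke n) (x : ZeroRook n) :
    heckePart (ZeroHecke.toZeroRook n a * x) = a * heckePart x := by
  apply ZeroHecke.wordAct_injective (strictMono_sortedWord x)
  dsimp only
  rw [ZeroHecke.wordAct_mul, wordAct_heckePart, ← standardize_colWord_toZeroRook_mul,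
    ← wordAct_heckePart, sortedWord_toZeroRook_mul]

theorem orbitRep_toZeroRook_mul (a : ZeroHecke n) (x : ZeroRook n) :
    orbitRep (ZeroHecke.toZeroRook n a * x) = orbitRep x :=
  colWord_injective (Subtype.ext (by
    rw [colWord_orbitRep, colWord_orbitRep, sortedWord_toZeroRook_mul]))

/-- Merging the zeros is monotone, so it commutes with the action of `heckePart x`, which takes the
sorted word to the standardized column word. -/
theorem toZeroRook_heckePart_mul_orbitRep (x : ZeroRook n) :
    ZeroHecke.toZeroRook n (heckePart x) * orbitRep x = x := by
  apply colWord_injective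
  apply Subtype.ext
  rw [colWord_toZeroRook_mul, colWord_orbitRep, ZeroHecke.wordAct_comp Rook.monotone_fst_ofLex,
    wordAct_heckePart, Rook.fst_standardize]

end ZeroRook

theorem mainTheorem10 (n : ℕ) :
    Function.Injective (ZeroHecke.toZeroRook n) ∧
    (letI := ZeroHecke.restrict n (MonoidAlgebra ℂ (ZeroRook n));
      Module.Projective (MonoidAlgebra ℂ (ZeroHecke n)) (MonoidAlgebra ℂ (ZeroRook n))) ∧
    ∀ (M : Type*) [AddCommGroup M] [Module (MonoidAlgebra ℂ (ZeroRook n)) M],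
      Module.Projective (MonoidAlgebra ℂ (ZeroRook n)) M →
        (letI := ZeroHecke.restrict n M;
          Module.Projective (MonoidAlgebra ℂ (ZeroHecke n)) M) := by
  have h := MonoidAlgebra.projective_of_retract (k := ℂ) (ZeroHecke.toZeroRook n)
    ZeroRook.heckePart ZeroRook.orbitRep ZeroRook.heckePart_toZeroRook_mul
    ZeroRook.orbitRep_toZeroRook_mul ZeroRook.toZeroRook_heckePart_mul_orbitRep
  exact ⟨ZeroHecke.toZeroRook_injective n, h, fun M _ _ hM =>
    Module.Projective.compHom (ZeroHecke.algebraMap n) h M hM⟩
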